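/- Let $k,s\ge 1$, let $F=\mathbb{F}_{2^k}$, and let $A$ be a finite abelian group (written additively) of odd order. For a commutative ring $R$ and a finite abelian group $G$, a code in $R[G]$ is an ideal of $R[G]$ (a cyclic code of length $n$ over $R$ if $G=\mathbb{Z}_n$). The Euclidean dual $C^{\perp_E}$ of a code $C$ is the set of all $x=\sum_g\alpha_gY^g$ with $\sum_g\alpha_g\beta_g=0$ for all $\sum_g\beta_gY^g\in C$. If $R=\mathbb{F}_{q^2}+u\mathbb{F}_{q^2}$, $u^2=0$, the Hermitian dual $C^{\perp_H}$ is the set of all $x=\sum_g\alpha_gY^g$ with $\sum_g\alpha_g\rho(\beta_g)=0$ for all $\sum_g\beta_gY^g\in C$, where $\rho(v+uw)=v^q+uw^q$. A code is Euclidean (Hermitian) self-dual if it equals its Euclidean (Hermitian) dual. For $a\in A$ let $S(a)=\{2^{ki}a : i\ge 0\}$ be its $2^k$-cyclotomic class. The class is of type I if $a=-a$, of type II if $S(a)=S(-a)$ and $a\ne -a$, of type III if $S(a)\neq S(-a)$. Let $(a_i)_{i\le r_1}$, $(b_j)_{j\le r_2}$ and $(c_l)_{l\le r_3}$ together with $(-c_l)_{l\le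 r_3}$ be complete systems of representatives, without repetition, of the classes of types I, II and III. Let $K$ be an extension field of $F$ and let $a\mapsto\chi_a$ be an injective homomorphism from $A$ to the group of characters $A\to K^\times$ (for $A=\prod_i\mathbb{Z}_{m_i}$ of exponent $M$ one can take $\chi_a(g)=\zeta^{\sum_i (M/m_i)a_ig_i}$ with $\zeta\in K$ a primitive $M$-th root of unity). Let $L_a=F(\chi_a(g): g\in A)$ and, for a character $\psi:A\to L_a^\times$, let $$\Phi_\psi: F[A\times\mathbb{Z}_2\times\mathbb{Z}_{2^s}]\to (L_a+uL_a)[\mathbb{Z}_{2^s}],\qquad Y^{(g,z,w)}\mapsto \psi(g)(1+u)^zY^w ,$$ be the $F$-algebra homomorphism given by $\psi$. Then $|L_{a_i}|=2^k$ for all $i$; $|L_{b_j}|=2^{k|S(b_j)|}$ with $k|S(b_j)|$ even for all $j$; and $|L_{c_l}|=2^{k|S(c_l)|}$ for all $l$. Put $\mathcal{R}_i=L_{a_i}+uL_{a_i}$, $\mathcal{S}_j=L_{b_j}+uL_{b_j}$ and $\mathcal{T}_l=L_{c_l}+uL_{c_l}$. The maps $\Phi_{\chi_{a_i}}$, $\Phi_{\chi_{b_j}}$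 and $(\Phi_{\chi_{c_l}},\Phi_{\chi_{-c_l}})$ together form a ring isomorphism $$\Phi: F[A\times\mathbb{Z}_2\times\mathbb{Z}_{2^s}]\;\cong\;\prod_{i=1}^{r_1}\mathcal{R}_i[\mathbb{Z}_{2^s}]\times\prod_{j=1}^{r_2}\mathcal{S}_j[\mathbb{Z}_{2^s}]\times\prod_{l=1}^{r_3}\bigl(\mathcal{T}_l[\mathbb{Z}_{2^s}]\times\mathcal{T}_l[\mathbb{Z}_{2^s}]\bigr).$$ For every code $C$ in $F[A\times\mathbb{Z}_2\times\mathbb{Z}_{2^s}]$, let $B_i$, $C_j$, $D_l$ and $D_l'$ be the ideals generated by the images of $C$ under $\Phi_{\chi_{a_i}}$, $\Phi_{\chi_{b_j}}$, $\Phi_{\chi_{c_l}}$ and $\Phi_{\chi_{-c_l}}$. Then $\Phi(C)=\prod_iB_i\times\prod_jC_j\times\prod_l(D_l\times D_l')$, and $C$ is Euclidean self-dual if and only if 1. $B_i$ is a Euclidean self-dual cyclic code of length $2^s$ over $\mathcal{R}_i$ for all $i$; 2. $C_j$ is a Hermitian self-dual cyclic code of length $2^s$ over $\mathcal{S}_j$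 for all $j$; and 3. $D_l'=D_l^{\perp_E}$, as cyclic codes of length $2^s$ over $\mathcal{T}_l$, for all $l$. -/

import Mathlib

open scoped DualNumber

noncomputable section

namespace AbelianCode

/-! ### Abelian codes, inner products and duals

An abelian code in `R[G]` is an ideal of `AddMonoidAlgebra R G`; it is a cyclic code of length `n`
over `R` when `G = ZMod n`. -/

section Duals

variable {R G : Type*} [CommRing R] [AddCommGroup G] [Fintype G]

/-- The Euclidean inner product `∑ g, α_g β_g` on `R[G]`. -/
def euclideanInner (x y : AddMonoidAlgebra R G) : R :=
  ∑ g : G, x.coeff g * y.coeff g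

/-- The `ρ`-inner product `∑ g, α_g ρ(β_g)` on `R[G]`. -/
def twistedInner (ρ : R → R) (x y : AddMonoidAlgebra R G) : R :=
  ∑ g : G, x.coeff g * ρ (y.coeff g)

/-- The Euclidean dual of a code. -/
def euclideanDual (C : Ideal (AddMonoidAlgebra R G)) : Set (AddMonoidAlgebra R G) :=
  {x | ∀ y ∈ C, euclideanInner x y = 0}

/-- `C` is Euclidean self-dual: it equals its Euclidean dual. -/
def IsEuclideanSelfDual (C : Ideal (AddMonoidAlgebra R G)) : Prop :=
  (C : Set (AddMonoidAlgebra R G)) = euclideanDual C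

variable {L : Type*} [Field L]

/-- The map `x + u y ↦ x ^ q + u y ^ q` on `L + uL` (`u ^ 2 = 0`), where `L` is a finite field of
square order `q ^ 2`. -/
def hermitianConj (z : L[ε]) : L[ε] :=
  TrivSqZeroExt.inl (z.fst ^ Nat.sqrt (Nat.card L)) +
    TrivSqZeroExt.inr (z.snd ^ Nat.sqrt (Nat.card L))

/-- The Hermitian dual of a code over `L + uL`, for `L` a finite field of square order. -/
def hermitianDual (C : Ideal (AddMonoidAlgebra L[ε] G)) : Set (AddMonoidAlgebra L[ε] G) :=
  {x | ∀ y ∈ C, twistedInner hermitianConj x y = 0}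

/-- `C` is Hermitian self-dual: it equals its Hermitian dual. -/
def IsHermitianSelfDual (C : Ideal (AddMonoidAlgebra L[ε] G)) : Prop :=
  (C : Set (AddMonoidAlgebra L[ε] G)) = hermitianDual C

end Duals

/-! ### Cyclotomic classes -/

section Cyclotomic

variable {A : Type*} [AddCommGroup A]

/-- The `2 ^ k`-cyclotomic class of `A` containing `a`. -/
def cyclotomicClass (k : ℕ) (a : A) : Set A :=
  {x | ∃ i : ℕ, x = 2 ^ (k * i) • a}

/-- The class of `a` is of type I. -/
def IsTypeI (a : A) : Prop :=
  a = -a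

/-- The class of `a` is of type II. -/
def IsTypeII (k : ℕ) (a : A) : Prop :=
  cyclotomicClass k a = cyclotomicClass k (-a) ∧ a ≠ -a

/-- The class of `a` is of type III. -/
def IsTypeIII (k : ℕ) (a : A) : Prop :=
  cyclotomicClass k (-a) ≠ cyclotomicClass k a

/-- The family `f` is a complete system of representatives, without repetition, of the
`2 ^ k`-cyclotomic classes of type `P`. -/
def IsRepresentatives (k : ℕ) (P : A → Prop) {ι : Type*} (f : ι → A) : Prop :=
  (∀ i, P (f i)) ∧ ∀ x, P x → ∃! i, cyclotomicClass k x = cyclotomicClass k (f i)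

end Cyclotomic

/-! ### The decomposition of `F[A × ℤ₂ × ℤ_{2^s}]` by the discrete Fourier transform

`χ : AddChar A (AddChar A K)` is a pairing `A × A → Kˣ`, `(a, g) ↦ χ a g`, that is additive to
multiplicative in both variables. When `A` is written as a product of groups `ℤ_{m_i}` of exponent
`M`, a standard choice is `χ a g = ζ ^ (∑ i, (M / m_i) a_i g_i)` for a primitive `M`-th root of
unity `ζ`. -/

section Decomposition

variable {F K A : Type*} [Field F] [Field K] [Algebra F K] [AddCommGroup A]

variable (F) in
/-- The extension of `F` generated by the values of the character `χ a`. It is the image of `F[A]`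
under `Y ^ g ↦ χ a g`, that is, the simple component of `F[A]` at the class of `a`. -/
abbrev componentField (χ : AddChar A (AddChar A K)) (a : A) : IntermediateField F K :=
  IntermediateField.adjoin F (Set.range (χ a))

variable (F) in
/-- The character `χ a`, with values in the field they generate. -/
def componentChar (χ : AddChar A (AddChar A K)) (a : A) : AddChar A (componentField F χ a) where
  toFun g := ⟨χ a g, IntermediateField.subset_adjoin F _ ⟨g, rfl⟩⟩
  map_zero_eq_one' := Subtype.ext (AddChar.map_zero_eq_one _)
  map_add_eq_mul' g h := Subtype.ext (AddChar.map_add_eq_mul _ g h)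

theorem coe_componentChar (χ : AddChar A (AddChar A K)) (a g : A) :
    (componentChar F χ a g : K) = χ a g := rfl

/-- The inverse of the character `χ a` is the character `χ (-a)`. -/
theorem coe_componentChar_inv (χ : AddChar A (AddChar A K)) (a g : A) :
    ((componentChar F χ a)⁻¹ g : K) = χ (-a) g := by
  rw [AddChar.inv_apply, coe_componentChar, AddChar.map_neg_eq_inv χ a, AddChar.inv_apply]

variable {L : Type*} [Field L] [Algebra F L]

variable (F L) in
theorem one_add_eps_sq [CharP F 2] : (1 + ε : L[ε]) ^ 2 = 1 := by
  have h : (2 : L[ε]) = 0 := by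
    rw [← map_ofNat (algebraMap F L[ε]) 2, CharTwo.two_eq_zero, map_zero]
  linear_combination ((ε : L[ε]) * h + DualNumber.eps_mul_eps (R := L))

/-- The monomials: `(g, z, w) ↦ ψ(g) (1 + u) ^ z Y ^ w`. -/
def monomialHom [CharP F 2] (s : ℕ) (ψ : AddChar A L) :
    Multiplicative (A × ZMod 2 × ZMod (2 ^ s)) →*
      AddMonoidAlgebra L[ε] (ZMod (2 ^ s)) where
  toFun x := AddMonoidAlgebra.single x.toAdd.2.2
    (algebraMap L L[ε] (ψ x.toAdd.1) * AddChar.zmodChar 2 (one_add_eps_sq F L) x.toAdd.2.1)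
  map_one' := by
    simp [AddMonoidAlgebra.one_def]
  map_mul' x y := by
    simp only [toAdd_mul, Prod.fst_add, Prod.snd_add, AddChar.map_add_eq_mul, map_mul,
      AddMonoidAlgebra.single_mul_single]
    congr 1
    ring

/-- The component of the decomposition of `F[A × ℤ₂ × ℤ_{2^s}]` at the character `ψ`: the
`F`-algebra homomorphism to `(L + uL)[ℤ_{2^s}]`, with `u ^ 2 = 0`, sending
`Y ^ (g, z, w)` to `ψ(g) (1 + u) ^ z Y ^ w`. -/
def componentHom [CharP F 2] (s : ℕ) (ψ : AddChar A L) :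
    AddMonoidAlgebra F (A × ZMod 2 × ZMod (2 ^ s)) →ₐ[F]
      AddMonoidAlgebra L[ε] (ZMod (2 ^ s)) :=
  AddMonoidAlgebra.lift F _ _ (monomialHom (F := F) s ψ)

theorem componentHom_single [CharP F 2] (s : ℕ) (ψ : AddChar A L) (α : F) (g : A) (z : ZMod 2)
    (w : ZMod (2 ^ s)) :
    componentHom s ψ (AddMonoidAlgebra.single (g, z, w) α) =
      AddMonoidAlgebra.single w
        (algebraMap F L[ε] α * algebraMap L L[ε] (ψ g) * (1 + ε) ^ z.val) := by
  simp [componentHom, monomialHom, AddChar.zmodChar_apply, Algebra.smul_def, mul_assoc]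

variable [CharP F 2] (χ : AddChar A (AddChar A K)) (s : ℕ)

/-- The component of the code `C` at the character `χ a`, a cyclic code of length `2 ^ s`. -/
def component (C : Ideal (AddMonoidAlgebra F (A × ZMod 2 × ZMod (2 ^ s)))) (a : A) :
    Ideal (AddMonoidAlgebra (componentField F χ a)[ε] (ZMod (2 ^ s))) :=
  C.map (componentHom s (componentChar F χ a))

/-- The component of the code `C` at the character `χ (-a) = (χ a)⁻¹`, over the same ring as the
component at `χ a`. -/
def componentNeg (C : Ideal (AddMonoidAlgebra F (A × ZMod 2 × ZMod (2 ^ s)))) (a : A) :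
    Ideal (AddMonoidAlgebra (componentField F χ a)[ε] (ZMod (2 ^ s))) :=
  C.map (componentHom s (componentChar F χ a)⁻¹)

variable (F) in
/-- The map from `F[A × ℤ₂ × ℤ_{2^s}]` to the product of the component rings
`∏ᵢ Rᵢ[ℤ_{2^s}] × ∏ⱼ Sⱼ[ℤ_{2^s}] × ∏ₗ (Tₗ[ℤ_{2^s}] × Tₗ[ℤ_{2^s}])`, for representatives `aᵢ`, `bⱼ`,
`± cₗ` of the cyclotomic classes of types I, II, III. -/
def decomposition {r₁ r₂ r₃ : ℕ} (a : Fin r₁ → A) (b : Fin r₂ → A) (c : Fin r₃ → A) :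
    AddMonoidAlgebra F (A × ZMod 2 × ZMod (2 ^ s)) →ₐ[F]
      (∀ i, AddMonoidAlgebra (componentField F χ (a i))[ε] (ZMod (2 ^ s))) ×
      (∀ j, AddMonoidAlgebra (componentField F χ (b j))[ε] (ZMod (2 ^ s))) ×
      (∀ l, AddMonoidAlgebra (componentField F χ (c l))[ε] (ZMod (2 ^ s)) ×
        AddMonoidAlgebra (componentField F χ (c l))[ε] (ZMod (2 ^ s))) :=
  AlgHom.prod (AlgHom.pi fun i => componentHom s (componentChar F χ (a i)))
    (AlgHom.prod (AlgHom.pi fun j => componentHom s (componentChar F χ (b j)))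
      (AlgHom.pi fun l => AlgHom.prod (componentHom s (componentChar F χ (c l)))
        (componentHom s (componentChar F χ (c l))⁻¹)))

end Decomposition

end AbelianCode

end

noncomputable section

namespace AbelianCode

/-! The coefficients of `x * conj y`, where conj is the involution `Y ^ g ↦ Y ^ (-g)` with a twist
`ρ` on coefficients, are the inner products of `x` with the shifts of `y`. So the dual of a code is
the annihilator of its conjugate, and self-duality becomes a ring-theoretic condition that can be
tested in each factor of a product (`coe_eq_annihilator_iff`), once the action of the involution on
the factors is known.

The involution relates the factors at `χ a` and `χ (-a)` and fixes `u`, since `1 + u` is its own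
inverse. For type I, `a = 0`. For type II, a class of size `2 n` has `-a = 2 ^ (k n) a`, so
inverting the character is the Frobenius `x ↦ x ^ q` with `q ^ 2 = |L|`: this is Hermitian duality.
For type III two factors are exchanged, and the conditions `D = D'^⊥` and `D' = D^⊥` are equivalent
by double duality (`eq_euclideanDual_symm`).

The decomposition is injective because distinct characters are linearly independent and Frobenius
passes from a representative to its whole class. It is then bijective by counting, since the classes
are disjoint and `|L_a| = 2 ^ (k |S(a)|)`. -/

theorem euclideanInner_comm {R G : Type*} [CommRing R] [Fintype G] (x y : AddMonoidAlgebra R G) :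
    euclideanInner x y = euclideanInner y x :=
  Finset.sum_congr rfl fun _ _ => mul_comm _ _

/-! ### Duals as annihilators -/

section Conjugation

variable {R G : Type*} [CommRing R] [AddCommGroup G]

/-- The ring endomorphism `∑ g, α_g Y ^ g ↦ ∑ g, ρ(α_g) Y ^ (-g)` of `R[G]`. -/
def conjHom (ρ : R →+* R) : AddMonoidAlgebra R G →+* AddMonoidAlgebra R G :=
  (AddMonoidAlgebra.mapRingHom G ρ).comp (AddMonoidAlgebra.mapDomainRingHom R (-AddMonoidHom.id G))

theorem conjHom_single (ρ : R →+* R) (g : G) (r : R) :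
    conjHom ρ (AddMonoidAlgebra.single g r) = AddMonoidAlgebra.single (-g) (ρ r) := by
  simp [conjHom]

theorem coeff_conjHom (ρ : R →+* R) (x : AddMonoidAlgebra R G) (g : G) :
    (conjHom ρ x).coeff g = ρ (x.coeff (-g)) := by
  classical
  induction x using AddMonoidAlgebra.induction_linear with
  | zero => simp
  | add x y hx hy => simp [hx, hy]
  | single h r =>
    rw [conjHom_single, AddMonoidAlgebra.coeff_single, AddMonoidAlgebra.coeff_single, Finsupp.single_apply,
      Finsupp.single_apply]
    simp only [neg_eq_iff_eq_neg]
    split_ifs <;> simp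

variable [Fintype G]

theorem coeff_mul_conjHom (ρ : R →+* R) (x y : AddMonoidAlgebra R G) (h : G) :
    (x * conjHom ρ y).coeff h = twistedInner ρ x (AddMonoidAlgebra.single h 1 * y) := by
  rw [AddMonoidAlgebra.coeff_mul_apply_left, Finsupp.sum_fintype _ _ (by simp)]
  simp [twistedInner, coeff_conjHom, AddMonoidAlgebra.coeff_single_mul_apply, add_comm]

/-- An ideal is closed under shifts, so orthogonality to all of `C` kills every coefficient of the
product, not only the one at `0`. -/
theorem forall_twistedInner_eq_zero_iff (ρ : R →+* R) (C : Ideal (AddMonoidAlgebra R G))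
    (x : AddMonoidAlgebra R G) :
    (∀ y ∈ C, twistedInner ρ x y = 0) ↔ ∀ y ∈ C, x * conjHom ρ y = 0 := by
  refine ⟨fun hx y hy => AddMonoidAlgebra.ext (Finsupp.ext fun h => ?_), fun hx y hy => ?_⟩
  · rw [coeff_mul_conjHom, hx _ (C.mul_mem_left _ hy)]
    rfl
  · have := coeff_mul_conjHom ρ x y 0
    rwa [hx y hy, ← AddMonoidAlgebra.one_def, one_mul, eq_comm] at this

theorem mem_euclideanDual_iff (C : Ideal (AddMonoidAlgebra R G)) (x : AddMonoidAlgebra R G) :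
    x ∈ euclideanDual C ↔ ∀ y ∈ C, x * conjHom (RingHom.id R) y = 0 :=
  forall_twistedInner_eq_zero_iff (RingHom.id R) C x

end Conjugation

/-! ### Double duality over `L + uL` -/

section DoubleDual

variable {L G : Type*} [Field L] [Fintype G]

variable (L G) in
/-- The `L`-bilinear form on `(L + uL)[G]` given by the `u`-part of the Euclidean inner product. -/
def sndForm : LinearMap.BilinForm L (AddMonoidAlgebra L[ε] G) :=
  LinearMap.mk₂ L (fun x y => (euclideanInner x y).snd)
    (fun x y z => by simp [euclideanInner, add_mul, Finset.sum_add_distrib])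
    (fun c x y => by
      simp only [euclideanInner, AddMonoidAlgebra.coeff_smul_apply, smul_mul_assoc,
        ← Finset.smul_sum, TrivSqZeroExt.snd_smul])
    (fun x y z => by simp [euclideanInner, mul_add, Finset.sum_add_distrib])
    (fun c x y => by
      simp only [euclideanInner, AddMonoidAlgebra.coeff_smul_apply, mul_smul_comm,
        ← Finset.smul_sum, TrivSqZeroExt.snd_smul])

theorem sndForm_apply (x y : AddMonoidAlgebra L[ε] G) :
    sndForm L G x y = (euclideanInner x y).snd := rfl

theorem euclideanInner_single (x : AddMonoidAlgebra L[ε] G) (g : G) (r : L[ε]) :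
    euclideanInner x (AddMonoidAlgebra.single g r) = x.coeff g * r := by
  classical
  simp [euclideanInner, Finsupp.single_apply]

theorem sndForm_isSymm : (sndForm L G).IsSymm :=
  ⟨fun x y => by simp [sndForm_apply, euclideanInner_comm x y]⟩

/-- Multiplication by `ε` moves the constant part of a coefficient into the `u`-part: pairing with
`ε Y ^ g` reads off the constant part, pairing with `Y ^ g` the `u`-part. -/
theorem sndForm_nondegenerate : (sndForm L G).Nondegenerate := by
  refine (LinearMap.IsRefl.nondegenerate_iff_separatingLeft
    (sndForm_isSymm (L := L) (G := G)).isRefl).2 fun x hx => ?_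
  refine AddMonoidAlgebra.ext (Finsupp.ext fun g => TrivSqZeroExt.ext ?_ ?_)
  · simpa [sndForm_apply, euclideanInner_single] using hx (AddMonoidAlgebra.single g ε)
  · simpa [sndForm_apply, euclideanInner_single] using hx (AddMonoidAlgebra.single g 1)

theorem finiteDimensional_addMonoidAlgebra :
    FiniteDimensional L (AddMonoidAlgebra L[ε] G) :=
  have : Module.Finite L L[ε] := inferInstanceAs (Module.Finite L (L × L))
  Module.Finite.equiv (AddMonoidAlgebra.coeffLinearEquiv L (S := L[ε]) (M := G)).symm

variable [AddCommGroup G]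

theorem euclideanInner_smul_single (x y : AddMonoidAlgebra L[ε] G) (r : L[ε]) :
    euclideanInner x (AddMonoidAlgebra.single 0 r * y) = r * euclideanInner x y := by
  simp [euclideanInner, AddMonoidAlgebra.coeff_single_mul_apply, Finset.mul_sum, mul_left_comm]

/-- Since `C` is stable under multiplication by `ε`, testing only the `u`-part of the inner product
loses nothing. This reduces double duality to linear algebra over the field `L`. -/
theorem mem_euclideanDual_iff_mem_orthogonal (C : Ideal (AddMonoidAlgebra L[ε] G))
    (x : AddMonoidAlgebra L[ε] G) :
    x ∈ euclideanDual C ↔ x ∈ (sndForm L G).orthogonal (C.restrictScalars L) := by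
  refine ⟨fun hx y hy => ?_, fun hx y hy => ?_⟩
  · show (euclideanInner y x).snd = 0
    rw [euclideanInner_comm, hx y hy, TrivSqZeroExt.snd_zero]
  · have key : ∀ r : L[ε], (r * euclideanInner x y).snd = 0 := fun r => by
      rw [← euclideanInner_smul_single, euclideanInner_comm]
      exact hx _ (C.mul_mem_left _ hy)
    refine TrivSqZeroExt.ext ?_ ?_
    · simpa using key ε
    · simpa using key 1

theorem eq_euclideanDual_symm {C D : Ideal (AddMonoidAlgebra L[ε] G)}
    (h : (D : Set (AddMonoidAlgebra L[ε] G)) = euclideanDual C) :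
    (C : Set (AddMonoidAlgebra L[ε] G)) = euclideanDual D := by
  have := finiteDimensional_addMonoidAlgebra (L := L) (G := G)
  have hD : D.restrictScalars L = (sndForm L G).orthogonal (C.restrictScalars L) :=
    Submodule.ext fun x => by
      rw [← mem_euclideanDual_iff_mem_orthogonal, ← h]
      rfl
  ext x
  rw [mem_euclideanDual_iff_mem_orthogonal, hD,
    LinearMap.BilinForm.orthogonal_orthogonal sndForm_nondegenerate sndForm_isSymm.isRefl]
  rfl

end DoubleDual

/-! ### Hermitian duality and Frobenius -/

section Hermitian

variable {L : Type*} [Field L]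

/-- The ring endomorphism `v + u w ↦ v ^ (2 ^ n) + u w ^ (2 ^ n)` of `L + uL`. -/
def dualFrobenius (L : Type*) [Field L] [CharP L 2] (n : ℕ) : L[ε] →+* L[ε] where
  toFun z := TrivSqZeroExt.inl (iterateFrobenius L 2 n z.fst) +
    TrivSqZeroExt.inr (iterateFrobenius L 2 n z.snd)
  map_one' := by ext <;> simp
  map_mul' x y := by ext <;> simp [mul_comm]
  map_zero' := by ext <;> simp
  map_add' x y := by ext <;> simp

theorem hermitianConj_eq_dualFrobenius [CharP L 2] {n : ℕ} (h : Nat.card L = 2 ^ (n * 2)) :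
    (hermitianConj : L[ε] → L[ε]) = dualFrobenius L n := by
  funext z
  have : Nat.sqrt (Nat.card L) = 2 ^ n := by rw [h, pow_mul, Nat.sqrt_eq']
  simp [hermitianConj, dualFrobenius, this, iterateFrobenius_def]

theorem mem_hermitianDual_iff [CharP L 2] {n : ℕ} (h : Nat.card L = 2 ^ (n * 2)) {G : Type*}
    [AddCommGroup G] [Fintype G] (C : Ideal (AddMonoidAlgebra L[ε] G))
    (x : AddMonoidAlgebra L[ε] G) :
    x ∈ hermitianDual C ↔ ∀ y ∈ C, x * conjHom (dualFrobenius L n) y = 0 := by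
  rw [← forall_twistedInner_eq_zero_iff, ← hermitianConj_eq_dualFrobenius h]
  rfl

end Hermitian

/-! ### Cyclotomic classes in a group of odd order -/

section Cyclotomic

variable {A : Type*} [AddCommGroup A]

theorem iterate_two_pow_nsmul (k i : ℕ) (x : A) :
    (fun y : A => 2 ^ k • y)^[i] x = 2 ^ (k * i) • x := by
  induction i with
  | zero => simp
  | succ i ih => rw [Function.iterate_succ_apply', ih, smul_smul, ← pow_add, Nat.mul_succ, add_comm]

theorem mem_cyclotomicClass_iff {k : ℕ} {a x : A} :
    x ∈ cyclotomicClass k a ↔ ∃ i, (fun y : A => 2 ^ k • y)^[i] a = x := by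
  simp [cyclotomicClass, iterate_two_pow_nsmul, eq_comm]

theorem self_mem_cyclotomicClass (k : ℕ) (a : A) : a ∈ cyclotomicClass k a :=
  ⟨0, by simp⟩

theorem cyclotomicClass_neg (k : ℕ) (a : A) :
    cyclotomicClass k (-a) = Neg.neg '' cyclotomicClass k a := by
  ext x
  constructor
  · rintro ⟨i, rfl⟩
    exact ⟨_, ⟨i, rfl⟩, by simp⟩
  · rintro ⟨_, ⟨i, rfl⟩, rfl⟩
    exact ⟨i, by simp⟩

theorem ncard_cyclotomicClass_neg (k : ℕ) (a : A) :
    (cyclotomicClass k (-a)).ncard = (cyclotomicClass k a).ncard := by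
  rw [cyclotomicClass_neg, Set.ncard_image_of_injective _ neg_injective]

theorem ncard_cyclotomicClass_zero (k : ℕ) : (cyclotomicClass k (0 : A)).ncard = 1 := by
  rw [show cyclotomicClass k (0 : A) = {0} by ext; simp [cyclotomicClass], Set.ncard_singleton]

variable [Fintype A] (hA : Odd (Fintype.card A))

include hA

theorem two_pow_nsmul_injective (k : ℕ) : Function.Injective fun x : A => 2 ^ k • x :=
  (nsmulCoprime (G := A) (n := 2 ^ k) (by
    rw [Nat.card_eq_fintype_card]
    exact (Nat.coprime_two_right.2 hA).pow_right k)).injective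

theorem IsTypeI.eq_zero {a : A} (h : IsTypeI a) : a = 0 :=
  two_pow_nsmul_injective hA 1 (by
    have : a + a = 0 := eq_neg_iff_add_eq_zero.1 h
    simpa [two_nsmul] using this)

theorem mem_periodicPts_two_pow_nsmul (k : ℕ) (a : A) :
    a ∈ Function.periodicPts fun x : A => 2 ^ k • x :=
  (two_pow_nsmul_injective hA k).mem_periodicPts a

/-- In odd order, multiplication by `2 ^ k` is a permutation, and the class is its periodic orbit
through `a`. -/
theorem ncard_cyclotomicClass (k : ℕ) (a : A) :
    (cyclotomicClass k a).ncard = Function.minimalPeriod (fun x : A => 2 ^ k • x) a := by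
  classical
  have hnd := Function.nodup_periodicOrbit (f := fun x : A => 2 ^ k • x) (x := a)
  have : cyclotomicClass k a = ((Function.periodicOrbit (fun x : A => 2 ^ k • x) a).toFinset) := by
    ext x
    rw [mem_cyclotomicClass_iff,
      ← Function.mem_periodicOrbit_iff (mem_periodicPts_two_pow_nsmul hA k a),
      Function.periodicOrbit, Cycle.coe_toFinset, Finset.mem_coe, List.mem_toFinset,
      Cycle.mem_coe_iff]
  rw [this, Set.ncard_coe_finset, ← Function.periodicOrbit_length]
  rw [Function.periodicOrbit] at hnd ⊢
  exact List.toFinset_card_of_nodup hnd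

theorem two_pow_nsmul_eq_self_iff (k n : ℕ) (a : A) :
    2 ^ (k * n) • a = a ↔ (cyclotomicClass k a).ncard ∣ n := by
  rw [ncard_cyclotomicClass hA, ← Function.isPeriodicPt_iff_minimalPeriod_dvd,
    Function.IsPeriodicPt, Function.IsFixedPt, iterate_two_pow_nsmul]

theorem ncard_cyclotomicClass_pos (k : ℕ) (a : A) : 0 < (cyclotomicClass k a).ncard := by
  rw [ncard_cyclotomicClass hA]
  exact Function.minimalPeriod_pos_of_mem_periodicPts (mem_periodicPts_two_pow_nsmul hA k a)

theorem cyclotomicClass_eq_of_mem {k : ℕ} {a x : A} (hx : x ∈ cyclotomicClass k a) :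
    cyclotomicClass k x = cyclotomicClass k a := by
  have trans : ∀ {x y z : A}, x ∈ cyclotomicClass k y → y ∈ cyclotomicClass k z →
      x ∈ cyclotomicClass k z := by
    rintro _ _ z ⟨i, rfl⟩ ⟨j, rfl⟩
    exact ⟨i + j, by rw [smul_smul, ← pow_add, mul_add]⟩
  have symm : a ∈ cyclotomicClass k x := by
    obtain ⟨i, rfl⟩ := hx
    set m := (cyclotomicClass k a).ncard with hm
    -- `m * i` is a multiple of the period that is at least `i`, so `m * i - i` further steps lead
    -- from `2 ^ (k * i) • a` back to `a`.
    refine ⟨m * i - i, ?_⟩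
    have hmi : i ≤ m * i := Nat.le_mul_of_pos_left i (ncard_cyclotomicClass_pos hA k a)
    rw [smul_smul, ← pow_add, ← mul_add, Nat.sub_add_cancel hmi,
      (two_pow_nsmul_eq_self_iff hA k (m * i) a).2 (Dvd.intro _ rfl)]
  exact Set.Subset.antisymm (fun y hy => trans hy hx) (fun y hy => trans hy symm)

/-- A class of type II has even size `2 n` and `-a = (2 ^ k) ^ n a`. -/
theorem IsTypeII.exists_half {k : ℕ} {a : A} (h : IsTypeII k a) :
    ∃ n, (cyclotomicClass k a).ncard = n * 2 ∧ -a = 2 ^ (k * n) • a := by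
  obtain ⟨i, hi⟩ : -a ∈ cyclotomicClass k a := h.1 ▸ self_mem_cyclotomicClass k (-a)
  set m := (cyclotomicClass k a).ncard with hm
  have h1 : m ∣ i * 2 := by
    rw [← two_pow_nsmul_eq_self_iff hA, mul_two, mul_add, pow_add, mul_smul, ← hi, smul_neg, ← hi,
      neg_neg]
  have h2 : ¬ m ∣ i := fun hd => h.2 (by
    rw [hi, (two_pow_nsmul_eq_self_iff hA k i a).2 hd])
  have h3 : Even m := by
    by_contra hodd
    exact h2 ((Nat.coprime_two_right.2 (Nat.not_even_iff_odd.1 hodd)).dvd_of_dvd_mul_right h1)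
  obtain ⟨n, hn⟩ := h3
  rw [← mul_two] at hn
  refine ⟨n, hn, ?_⟩
  -- Write `i = n d`. An even `d` would give `m ∣ i`, hence `-a = a`; so `d` is odd and `i ≡ n`
  -- modulo the period `m = 2 n`.
  obtain ⟨d, hd⟩ : n ∣ i := Nat.dvd_of_mul_dvd_mul_right two_pos (hn ▸ h1)
  have hodd : Odd d := by
    rw [← Nat.not_even_iff_odd]
    rintro ⟨e, he⟩
    exact h2 ⟨e, by rw [hd, he, hn]; ring⟩
  obtain ⟨e, rfl⟩ := hodd
  rw [hi, hd, show n * (2 * e + 1) = n + m * e by rw [hn]; ring, mul_add, pow_add, mul_smul,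
    (two_pow_nsmul_eq_self_iff hA k (m * e) a).2 (Dvd.intro _ rfl)]

end Cyclotomic

/-! ### Orders of the component fields -/

theorem card_le_of_forall_pow_eq_self {L : Type*} [Field L] [Finite L] {N : ℕ} (hN : 1 < N)
    (h : ∀ x : L, x ^ N = x) : Nat.card L ≤ N := by
  classical
  have := Fintype.ofFinite L
  have hd : (Polynomial.X ^ N - Polynomial.X : Polynomial L).natDegree = N :=
    FiniteField.X_pow_card_sub_X_natDegree_eq L hN
  have h0 : (Polynomial.X ^ N - Polynomial.X : Polynomial L) ≠ 0 :=
    FiniteField.X_pow_card_sub_X_ne_zero L hN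
  rw [Nat.card_eq_fintype_card, ← Finset.card_univ, ← hd]
  refine Polynomial.card_le_degree_of_subset_roots fun x _ => ?_
  simp [Polynomial.mem_roots h0, h]

section Fields

variable {F K A : Type*} [Field F] [Field K] [Algebra F K] [AddCommGroup A]
  (χ : AddChar A (AddChar A K))

theorem apply_nsmul (n : ℕ) (a g : A) : χ (n • a) g = χ a g ^ n := by
  rw [AddChar.map_nsmul_eq_pow, AddChar.pow_apply]

theorem pow_two_pow_mul {k : ℕ} [Finite F] (hF : Nat.card F = 2 ^ k) (α : F) (i : ℕ) :
    α ^ 2 ^ (k * i) = α := by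
  have := Fintype.ofFinite F
  rw [pow_mul, ← hF, Nat.card_eq_fintype_card, FiniteField.pow_card_pow]

theorem pow_eq_self_of_mem_componentField [Finite F] [CharP F 2] {k : ℕ} (hF : Nat.card F = 2 ^ k)
    {n : ℕ} {a : A} (ha : 2 ^ (k * n) • a = a)
    (x : componentField F χ a) : x ^ 2 ^ (k * n) = x := by
  have : CharP K 2 := charP_of_injective_algebraMap (algebraMap F K).injective 2
  obtain ⟨x, hx⟩ := x
  refine Subtype.ext ?_
  change x ^ 2 ^ (k * n) = x
  induction hx using IntermediateField.adjoin_induction with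
  | mem x hx =>
    obtain ⟨g, rfl⟩ := hx
    rw [← apply_nsmul, ha]
  | algebraMap α => rw [← map_pow, pow_two_pow_mul hF]
  | add x y _ _ hx hy => rw [add_pow_char_pow, hx, hy]
  | inv x _ hx => rw [inv_pow, hx]
  | mul x y _ _ hx hy => rw [mul_pow, hx, hy]

variable [Fintype A]

theorem isIntegral_addChar (ψ : AddChar A K) (g : A) : IsIntegral F (ψ g) := by
  refine IsIntegral.of_pow Fintype.card_pos (n := Fintype.card A) ?_
  rw [← AddChar.map_nsmul_eq_pow, card_nsmul_eq_zero, AddChar.map_zero_eq_one]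
  exact isIntegral_one

theorem finiteDimensional_componentField (a : A) :
    FiniteDimensional F (componentField F χ a) := by
  have : Finite (Set.range (χ a)) := Set.finite_range _
  refine IntermediateField.finiteDimensional_adjoin ?_
  rintro _ ⟨g, rfl⟩
  exact isIntegral_addChar _ g

theorem finite_componentField [Finite F] (a : A) : Finite (componentField F χ a) :=
  have := finiteDimensional_componentField (F := F) χ a
  Module.finite_of_finite F

/-- The degree `n` is squeezed. The power `2 ^ (k m)` fixes the generating character values, hence
the field, so `n ≤ m` by counting roots. Conversely `x ^ |L| = x` on those values and injectivity of
`χ` give `2 ^ (k n) a = a`, so `m ∣ n`. -/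
theorem card_componentField [Finite F] [CharP F 2] {k : ℕ} (hF : Nat.card F = 2 ^ k)
    (hA : Odd (Fintype.card A)) (hχ : Function.Injective χ) (hk : 0 < k) (a : A) :
    Nat.card (componentField F χ a) = 2 ^ (k * (cyclotomicClass k a).ncard) := by
  have hfin := finite_componentField (F := F) χ a
  have hfd := finiteDimensional_componentField (F := F) χ a
  set m := (cyclotomicClass k a).ncard with hm
  have hmpos : 0 < m := ncard_cyclotomicClass_pos hA k a
  have hcard : Nat.card (componentField F χ a) =
      2 ^ (k * Module.finrank F (componentField F χ a)) := by
    have := Fintype.ofFinite F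
    have := Fintype.ofFinite (componentField F χ a)
    rw [pow_mul, ← hF, Nat.card_eq_fintype_card, Nat.card_eq_fintype_card]
    exact Module.card_eq_pow_finrank
  set n := Module.finrank F (componentField F χ a) with hn
  have hle : Nat.card (componentField F χ a) ≤ 2 ^ (k * m) :=
    card_le_of_forall_pow_eq_self (Nat.one_lt_two_pow (mul_pos hk hmpos).ne') fun x =>
      pow_eq_self_of_mem_componentField χ hF
        ((two_pow_nsmul_eq_self_iff hA k m a).2 dvd_rfl) x
  have hmn : m ∣ n := by
    rw [← two_pow_nsmul_eq_self_iff hA]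
    refine hχ (DFunLike.ext _ _ fun g => ?_)
    have := Fintype.ofFinite (componentField F χ a)
    rw [apply_nsmul, ← hcard, Nat.card_eq_fintype_card, ← coe_componentChar (F := F),
      ← SubmonoidClass.coe_pow, FiniteField.pow_card]
  rw [hcard] at hle ⊢
  have hnm : n ≤ m := Nat.le_of_mul_le_mul_left ((Nat.pow_le_pow_iff_right one_lt_two).1 hle) hk
  rw [le_antisymm hnm (Nat.le_of_dvd Module.finrank_pos hmn)]

end Fields

/-! ### Bijectivity by Fourier inversion and counting -/

theorem natCard_addMonoidAlgebra (R G : Type*) [CommRing R] [Finite G] :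
    Nat.card (AddMonoidAlgebra R G) = Nat.card R ^ Nat.card G := by
  rw [Nat.card_congr (AddMonoidAlgebra.coeffEquiv.trans Finsupp.equivFunOnFinite), Nat.card_fun]

theorem finite_addMonoidAlgebra (R G : Type*) [CommRing R] [Finite R] [Finite G] :
    Finite (AddMonoidAlgebra R G) :=
  Finite.of_equiv _ (AddMonoidAlgebra.coeffEquiv.trans Finsupp.equivFunOnFinite).symm

theorem finite_dualNumber (L : Type*) [Finite L] : Finite L[ε] :=
  inferInstanceAs (Finite (L × L))

theorem natCard_dualNumber (L : Type*) : Nat.card L[ε] = Nat.card L ^ 2 := by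
  rw [sq]
  exact Nat.card_prod L L

section Coefficients

variable {F L A : Type*} [Field F] [Field L] [Algebra F L] [AddCommGroup A] [Fintype A]
  [CharP F 2] {s : ℕ}

/-- The `u`-part isolates the slice `z = 1`; subtracting it from the constant part leaves the slice
`z = 0`. Each slice is an ordinary Fourier coefficient. -/
theorem coeff_componentHom (ψ : AddChar A L) (x : AddMonoidAlgebra F (A × ZMod 2 × ZMod (2 ^ s)))
    (w : ZMod (2 ^ s)) :
    ((componentHom s ψ x).coeff w).fst =
      (∑ g, ψ g * algebraMap F L (x.coeff (g, 0, w))) +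
        ∑ g, ψ g * algebraMap F L (x.coeff (g, 1, w)) ∧
    ((componentHom s ψ x).coeff w).snd = ∑ g, ψ g * algebraMap F L (x.coeff (g, 1, w)) := by
  classical
  induction x using AddMonoidAlgebra.induction_linear with
  | zero => simp
  | add x y hx hy =>
    simp only [map_add, AddMonoidAlgebra.coeff_add, Finsupp.add_apply, TrivSqZeroExt.fst_add,
      TrivSqZeroExt.snd_add, hx.1, hx.2, hy.1, hy.2, mul_add, Finset.sum_add_distrib, and_true]
    abel
  | single p r =>
    obtain ⟨h, z, v⟩ := p
    have alg (t : F) : algebraMap F L[ε] t = TrivSqZeroExt.inl (algebraMap F L t) := rfl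
    have alg' (t : L) : algebraMap L L[ε] t = TrivSqZeroExt.inl t := rfl
    rw [componentHom_single]
    simp only [AddMonoidAlgebra.coeff_single, Finsupp.single_apply, Prod.mk.injEq]
    by_cases hv : v = w
    · obtain rfl | rfl : z = 0 ∨ z = 1 := by decide +revert
      · simp [hv, alg, alg', apply_ite (algebraMap F L), mul_comm]
      · simp [hv, alg, alg', apply_ite (algebraMap F L), mul_comm, ZMod.val_one]
    · simp [hv]

end Coefficients

section Bijectivity

variable {F K A : Type*} [Field F] [Finite F] [Field K] [Algebra F K] [AddCommGroup A] [Fintype A]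
  {χ : AddChar A (AddChar A K)}

/-- Injectivity of the discrete Fourier transform on functions `A → K`. -/
theorem eq_zero_of_forall_sum_eq_zero (hχ : Function.Injective χ) {v : A → K}
    (hv : ∀ a, ∑ g, χ a g * v g = 0) : v = 0 := by
  classical
  -- Dedekind's independence of characters makes the square character matrix invertible.
  have hli : LinearIndependent K (Matrix.of fun a g => χ a g).row := by
    have h := linearIndependent_monoidHom (Multiplicative A) K
    have hinj : Function.Injective fun a => (χ a).toMonoidHom := fun a b hab =>
      hχ (AddChar.toMonoidHomEquiv.injective hab)
    exact h.comp _ hinj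
  have hunit := Matrix.linearIndependent_rows_iff_isUnit.1 hli
  refine Matrix.mulVec_injective_iff_isUnit.2 hunit ?_
  rw [Matrix.mulVec_zero]
  exact funext hv

variable [CharP F 2] {k : ℕ}

/-- For an `F`-valued function, one Fourier coefficient determines all those in its cyclotomic
class. -/
theorem sum_pow_two_pow_mul (hF : Nat.card F = 2 ^ k) (a : A) (α : A → F) (i : ℕ) :
    ∑ g, χ (2 ^ (k * i) • a) g * algebraMap F K (α g) =
      (∑ g, χ a g * algebraMap F K (α g)) ^ 2 ^ (k * i) := by
  have : CharP K 2 := charP_of_injective_algebraMap (algebraMap F K).injective 2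
  rw [sum_pow_char_pow]
  refine Finset.sum_congr rfl fun g _ => ?_
  rw [apply_nsmul, mul_pow, ← map_pow (algebraMap F K), pow_two_pow_mul hF]

variable {ι : Type*} {s : ℕ} {base rep : ι → A}
  {Ψ : ∀ i, AddChar A (componentField F χ (base i))}

/-- `base` and `rep` are kept apart because the component with character `χ (-c l)` is taken over
the field generated by `χ (c l)`. -/
theorem injective_pi_componentHom (hχ : Function.Injective χ) (hF : Nat.card F = 2 ^ k)
    (hΨ : ∀ i g, (Ψ i g : K) = χ (rep i) g) (hcov : ∀ x, ∃ i, x ∈ cyclotomicClass k (rep i)) :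
    Function.Injective fun (x : AddMonoidAlgebra F (A × ZMod 2 × ZMod (2 ^ s))) i =>
      componentHom s (Ψ i) x := by
  have aux (α : A → F) (h : ∀ i, ∑ g, Ψ i g * algebraMap F _ (α g) = 0) : α = 0 := by
    have := eq_zero_of_forall_sum_eq_zero hχ (v := fun g => algebraMap F K (α g)) fun a => by
      obtain ⟨i, j, rfl⟩ := hcov a
      rw [sum_pow_two_pow_mul hF]
      have := congrArg (algebraMap (componentField F χ (base i)) K) (h i)
      simp only [map_sum, map_mul, map_zero, IntermediateField.algebraMap_apply, hΨ] at this
      exact (congrArg (· ^ 2 ^ (k * j)) this).trans (zero_pow (by positivity))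
    funext g
    exact (map_eq_zero _).1 (congrFun this g)
  intro x y hxy
  rw [← sub_eq_zero]
  have h0 i : componentHom s (Ψ i) (x - y) = 0 := by
    rw [map_sub, sub_eq_zero]
    exact congrFun hxy i
  have h1 w : (fun g => (x - y).coeff (g, 1, w)) = 0 := aux _ fun i => by
    rw [← (coeff_componentHom (Ψ i) (x - y) w).2, h0]
    rfl
  have h2 w : (fun g => (x - y).coeff (g, 0, w)) = 0 := aux _ fun i => by
    have h := coeff_componentHom (Ψ i) (x - y) w
    rw [← h.2, h0] at h
    simpa using h.1.symm
  refine AddMonoidAlgebra.ext (Finsupp.ext fun p => ?_)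
  obtain ⟨g, z, w⟩ := p
  fin_cases z
  · exact congrFun (h2 w) g
  · exact congrFun (h1 w) g

theorem sum_ncard_cyclotomicClass_le [Fintype ι] (hA : Odd (Fintype.card A))
    (hdis : ∀ i j, cyclotomicClass k (rep i) = cyclotomicClass k (rep j) → i = j) :
    ∑ i, (cyclotomicClass k (rep i)).ncard ≤ Nat.card A := by
  have hinj : Function.Injective fun p : Σ i, cyclotomicClass k (rep i) => (p.2 : A) := by
    rintro ⟨i, x, hx⟩ ⟨j, y, hy⟩ (rfl : x = y)
    obtain rfl : i = j := hdis i j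
      ((cyclotomicClass_eq_of_mem hA hx).symm.trans (cyclotomicClass_eq_of_mem hA hy))
    rfl
  have := Nat.card_le_card_of_injective _ hinj
  rwa [Nat.card_sigma] at this

theorem bijective_pi_componentHom [Fintype ι] (hχ : Function.Injective χ)
    (hF : Nat.card F = 2 ^ k) (hA : Odd (Fintype.card A))
    (hΨ : ∀ i g, (Ψ i g : K) = χ (rep i) g) (hcov : ∀ x, ∃ i, x ∈ cyclotomicClass k (rep i))
    (hdis : ∀ i j, cyclotomicClass k (rep i) = cyclotomicClass k (rep j) → i = j)
    (hcard : ∀ i, Nat.card (componentField F χ (base i)) =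
      2 ^ (k * (cyclotomicClass k (rep i)).ncard)) :
    Function.Bijective fun (x : AddMonoidAlgebra F (A × ZMod 2 × ZMod (2 ^ s))) i =>
      componentHom s (Ψ i) x := by
  have hfin i : Finite (AddMonoidAlgebra (componentField F χ (base i))[ε] (ZMod (2 ^ s))) :=
    have := finite_componentField (F := F) χ (base i)
    have := finite_dualNumber (componentField F χ (base i))
    finite_addMonoidAlgebra _ _
  refine (injective_pi_componentHom hχ hF hΨ hcov).bijective_of_nat_card_le ?_
  simp only [Nat.card_pi, natCard_addMonoidAlgebra, natCard_dualNumber, hcard, Nat.card_prod,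
    Nat.card_zmod, hF, ← pow_mul, Finset.prod_pow_eq_pow_sum]
  refine Nat.pow_le_pow_right two_pos ?_
  have h := sum_ncard_cyclotomicClass_le hA hdis
  calc ∑ i, k * (cyclotomicClass k (rep i)).ncard * 2 * 2 ^ s
      = k * (∑ i, (cyclotomicClass k (rep i)).ncard) * 2 * 2 ^ s := by
        simp only [← Finset.sum_mul, ← Finset.mul_sum]
    _ ≤ k * Nat.card A * 2 * 2 ^ s := by gcongr
    _ = k * (Nat.card A * (2 * 2 ^ s)) := by ring

end Bijectivity

/-! ### Ideals and annihilators in a finite product -/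

section Ideals

variable {ι R : Type*} [CommRing R] {T : ι → Type*} [∀ i, CommRing (T i)] {φ : ∀ i, R →+* T i}

theorem surjective_of_bijective_pi (h : Function.Bijective fun x i => φ i x) (i : ι) :
    Function.Surjective (φ i) := by
  classical
  intro t
  obtain ⟨x, hx⟩ := h.2 (Pi.single i t)
  exact ⟨x, by simpa using congrFun hx i⟩

/-- Lifts `e i` of the coordinate idempotents glue preimages `c i ∈ C` of the components into `x = ∑
i, e i * c i`. -/
theorem mem_iff_forall_mem_map [Fintype ι] (h : Function.Bijective fun x i => φ i x)
    (C : Ideal R) (x : R) : x ∈ C ↔ ∀ i, φ i x ∈ C.map (φ i) := by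
  classical
  refine ⟨fun hx i => Ideal.mem_map_of_mem _ hx, fun hx => ?_⟩
  choose c hc hcx using fun i =>
    (Ideal.mem_map_iff_of_surjective _ (surjective_of_bijective_pi h i)).1 (hx i)
  choose e he using fun i => h.2 (Pi.single i 1)
  have : x = ∑ i, e i * c i := h.1 (by
    funext j
    have (i : ι) : φ j (e i) = (Pi.single i 1 : ∀ i, T i) j := congrFun (he i) j
    simp only [map_sum, map_mul, this]
    rw [Finset.sum_eq_single j (fun i _ hij => by rw [Pi.single_eq_of_ne hij.symm, zero_mul])
      (fun hj => absurd (Finset.mem_univ j) hj), Pi.single_eq_same, one_mul, hcx])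
  rw [this]
  exact C.sum_mem fun i _ => C.mul_mem_left _ (hc i)

/-- In a finite product, an ideal `C` is the annihilator of its image under `σ` if and only if
this holds componentwise, where the components of `σ` are `τ i : T (π i) → T i`. -/
theorem coe_eq_annihilator_iff [Fintype ι] (h : Function.Bijective fun x i => φ i x) (C : Ideal R)
    (σ : R → R) (π : ι → ι) (τ : ∀ i, T (π i) → T i) (hσ : ∀ i x, φ i (σ x) = τ i (φ (π i) x)) :
    (C : Set R) = {x | ∀ y ∈ C, x * σ y = 0} ↔
      ∀ i, (C.map (φ i) : Set (T i)) = {t | ∀ y ∈ C.map (φ (π i)), t * τ i y = 0} := by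
  classical
  have key (x : R) : (∀ y ∈ C, x * σ y = 0) ↔
      ∀ i, ∀ y ∈ C.map (φ (π i)), φ i x * τ i y = 0 := by
    constructor
    · intro hx i y hy
      obtain ⟨y, hyC, rfl⟩ :=
        (Ideal.mem_map_iff_of_surjective _ (surjective_of_bijective_pi h (π i))).1 hy
      rw [← hσ, ← map_mul, hx y hyC, map_zero]
    · intro hx y hy
      refine h.1 (funext fun i => ?_)
      simp only [map_mul, hσ, map_zero]
      exact hx i _ (Ideal.mem_map_of_mem _ hy)
  constructor
  · intro hC i
    ext t
    -- An element concentrated at coordinate `i` satisfies all the other conditions trivially, so it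
    -- tests the `i`-th one alone.
    obtain ⟨x, hx⟩ := h.2 (Pi.single i t)
    have hxi : φ i x = t := by simpa using congrFun hx i
    have hxj j (hj : j ≠ i) : φ j x = 0 := by simpa [hj] using congrFun hx j
    have h1 : x ∈ C ↔ t ∈ C.map (φ i) := by
      rw [mem_iff_forall_mem_map h]
      refine ⟨fun H => hxi ▸ H i, fun H j => ?_⟩
      by_cases hj : j = i
      · subst hj; rwa [hxi]
      · rw [hxj j hj]; exact zero_mem _
    have h2 : (∀ y ∈ C, x * σ y = 0) ↔ ∀ y ∈ C.map (φ (π i)), t * τ i y = 0 := by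
      rw [key]
      refine ⟨fun H => hxi ▸ H i, fun H j => ?_⟩
      by_cases hj : j = i
      · subst hj; rwa [hxi]
      · simp [hxj j hj]
    rw [SetLike.mem_coe, ← h1, Set.mem_ofPred_eq, ← h2]
    exact Set.ext_iff.1 hC x
  · intro H
    ext x
    rw [SetLike.mem_coe, mem_iff_forall_mem_map h, Set.mem_ofPred_eq, key]
    exact forall_congr' fun i => Set.ext_iff.1 (H i) (φ i x)

end Ideals

/-! ### The involution on components -/

section Involution

variable {F L A : Type*} [Field F] [Field L] [Algebra F L] [AddCommGroup A] [CharP F 2] {s : ℕ}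

theorem componentHom_conjHom {ψ ψ' : AddChar A L} {ρ : L[ε] →+* L[ε]} (hε : ρ ε = ε)
    (hF : ∀ α : F, ρ (algebraMap F L[ε] α) = algebraMap F L[ε] α)
    (hψ : ∀ g, ρ (algebraMap L L[ε] (ψ' g)) = algebraMap L L[ε] (ψ (-g)))
    (x : AddMonoidAlgebra F (A × ZMod 2 × ZMod (2 ^ s))) :
    componentHom s ψ (conjHom (RingHom.id F) x) = conjHom ρ (componentHom s ψ' x) := by
  induction x using AddMonoidAlgebra.induction_linear with
  | zero => simp
  | add x y hx hy => simp only [map_add, hx, hy]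
  | single p r =>
    obtain ⟨g, z, w⟩ := p
    -- Inversion is trivial on `ℤ₂`, so the powers of `1 + ε` must be fixed, as `hε` ensures.
    have hz : -z = z := by decide +revert
    rw [conjHom_single, Prod.neg_mk, Prod.neg_mk, componentHom_single, componentHom_single,
      conjHom_single, hz, map_mul, map_mul, hF, hψ, map_pow, map_add, map_one, hε, RingHom.id_apply]

theorem componentHom_inv_conjHom (ψ : AddChar A L)
    (x : AddMonoidAlgebra F (A × ZMod 2 × ZMod (2 ^ s))) :
    componentHom s ψ⁻¹ (conjHom (RingHom.id F) x) =
      conjHom (RingHom.id L[ε]) (componentHom s ψ x) :=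
  componentHom_conjHom rfl (fun _ => rfl) (fun g => by simp [AddChar.inv_apply]) x

theorem coe_eq_euclideanDual_iff {R G : Type*} [CommRing R] [AddCommGroup G] [Fintype G]
    (C : Ideal (AddMonoidAlgebra R G)) (S : Set (AddMonoidAlgebra R G)) :
    S = {t | ∀ y ∈ C, t * conjHom (RingHom.id R) y = 0} ↔ S = euclideanDual C := by
  rw [show euclideanDual C = {t | ∀ y ∈ C, t * conjHom (RingHom.id R) y = 0} from
    Set.ext fun x => mem_euclideanDual_iff C x]

end Involution

/-! ### Representatives of the three types -/

section Types

variable {A : Type*} [AddCommGroup A] [Fintype A] (hA : Odd (Fintype.card A)) {k : ℕ} {x y : A}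

include hA in
theorem IsTypeI.of_cyclotomicClass_eq (hx : IsTypeI x)
    (h : cyclotomicClass k x = cyclotomicClass k y) : IsTypeI y := by
  obtain ⟨i, hi⟩ : y ∈ cyclotomicClass k x := h ▸ self_mem_cyclotomicClass k y
  rw [hx.eq_zero hA, smul_zero] at hi
  simp [IsTypeI, hi]

omit [Fintype A] in
theorem cyclotomicClass_neg_eq_iff (h : cyclotomicClass k x = cyclotomicClass k y) :
    cyclotomicClass k (-x) = cyclotomicClass k x ↔
      cyclotomicClass k (-y) = cyclotomicClass k y := by
  rw [cyclotomicClass_neg, cyclotomicClass_neg, h]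

variable {ι₁ ι₂ ι₃ : Type*} {a : ι₁ → A} {b : ι₂ → A} {c : ι₃ → A}
  (ha : IsRepresentatives k IsTypeI a) (hb : IsRepresentatives k (IsTypeII k) b)
  (hc : IsRepresentatives k (IsTypeIII k) c)

include ha hb hc

omit [Fintype A] in
theorem exists_mem_cyclotomicClass (x : A) :
    ∃ i, x ∈ cyclotomicClass k (Sum.elim a (Sum.elim b c) i) := by
  by_cases h1 : IsTypeI x
  · obtain ⟨i, hi, -⟩ := ha.2 x h1
    exact ⟨.inl i, hi ▸ self_mem_cyclotomicClass k x⟩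
  by_cases h2 : cyclotomicClass k (-x) = cyclotomicClass k x
  · obtain ⟨i, hi, -⟩ := hb.2 x ⟨h2.symm, h1⟩
    exact ⟨.inr (.inl i), hi ▸ self_mem_cyclotomicClass k x⟩
  · obtain ⟨i, hi, -⟩ := hc.2 x h2
    exact ⟨.inr (.inr i), hi ▸ self_mem_cyclotomicClass k x⟩

-- The type depends only on the class, so classes of different types cannot coincide.
include hA in
theorem eq_of_cyclotomicClass_eq (i j : ι₁ ⊕ ι₂ ⊕ ι₃)
    (h : cyclotomicClass k (Sum.elim a (Sum.elim b c) i) =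
      cyclotomicClass k (Sum.elim a (Sum.elim b c) j)) : i = j := by
  have typeI_neg {x : A} (hx : IsTypeI x) : cyclotomicClass k (-x) = cyclotomicClass k x := by
    rw [← show x = -x from hx]
  rcases i with i | i | i <;> rcases j with j | j | j
  · rw [(ha.2 _ (ha.1 i)).unique rfl h]
  · exact absurd ((ha.1 i).of_cyclotomicClass_eq hA h) (hb.1 j).2
  · exact absurd ((cyclotomicClass_neg_eq_iff h).1 (typeI_neg (ha.1 i))) (hc.1 j)
  · exact absurd ((ha.1 j).of_cyclotomicClass_eq hA h.symm) (hb.1 i).2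
  · rw [(hb.2 _ (hb.1 i)).unique rfl h]
  · exact absurd ((cyclotomicClass_neg_eq_iff h).1 (hb.1 i).1.symm) (hc.1 j)
  · exact absurd ((cyclotomicClass_neg_eq_iff h).2 (typeI_neg (ha.1 j))) (hc.1 i)
  · exact absurd ((cyclotomicClass_neg_eq_iff h).2 (hb.1 j).1.symm) (hc.1 i)
  · rw [(hc.2 _ (hc.1 i)).unique rfl h]

end Types

/-! ### Indexing the components -/

section Components

variable {F K A : Type*} [Field F] [Field K] [Algebra F K] [AddCommGroup A]
  (χ : AddChar A (AddChar A K)) {r₁ r₂ r₃ : ℕ} (a : Fin r₁ → A) (b : Fin r₂ → A) (c : Fin r₃ → A)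

variable (F) in
/-- The characters giving the components of the decomposition; the component at `χ (-c l)` is
over the field of the component at `χ (c l)`. -/
def indexedChar : ∀ i : Fin r₁ ⊕ Fin r₂ ⊕ Fin r₃ ⊕ Fin r₃,
    AddChar A (componentField F χ (Sum.elim a (Sum.elim b (Sum.elim c c)) i))
  | .inl i => componentChar F χ (a i)
  | .inr (.inl j) => componentChar F χ (b j)
  | .inr (.inr (.inl l)) => componentChar F χ (c l)
  | .inr (.inr (.inr l)) => (componentChar F χ (c l))⁻¹

theorem coe_indexedChar (i : Fin r₁ ⊕ Fin r₂ ⊕ Fin r₃ ⊕ Fin r₃) (g : A) :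
    (indexedChar F χ a b c i g : K) =
      χ (Sum.elim a (Sum.elim b (Sum.elim c fun l => -c l)) i) g := by
  rcases i with i | j | l | l
  · rfl
  · rfl
  · rfl
  · exact coe_componentChar_inv χ (c l) g

/-- The exchange of the two components at `± c l`. -/
def conjIndex {ι₁ ι₂ ι₃ : Type*} : ι₁ ⊕ ι₂ ⊕ ι₃ ⊕ ι₃ → ι₁ ⊕ ι₂ ⊕ ι₃ ⊕ ι₃ :=
  Sum.map id (Sum.map id Sum.swap)

variable [CharP F 2] (s : ℕ)

/-- The action of the involution `Y ^ g ↦ Y ^ (-g)` of `F[A × ℤ₂ × ℤ_{2^s}]` on the components,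
for the powers `2 ^ n j` of the Frobenius at the representatives of type II. -/
def conjComponent [∀ i, CharP (componentField F χ i) 2] (n : Fin r₂ → ℕ) :
    ∀ i : Fin r₁ ⊕ Fin r₂ ⊕ Fin r₃ ⊕ Fin r₃,
    AddMonoidAlgebra
      (componentField F χ (Sum.elim a (Sum.elim b (Sum.elim c c)) (conjIndex i)))[ε]
        (ZMod (2 ^ s)) →
      AddMonoidAlgebra (componentField F χ (Sum.elim a (Sum.elim b (Sum.elim c c)) i))[ε]
        (ZMod (2 ^ s))
  | .inl _ => conjHom (RingHom.id _)
  | .inr (.inl j) => conjHom (dualFrobenius (componentField F χ (b j)) (n j))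
  | .inr (.inr (.inl _)) => conjHom (RingHom.id _)
  | .inr (.inr (.inr _)) => conjHom (RingHom.id _)

end Components

theorem componentChar_inv_of_isTypeI {F K A : Type*} [Field F] [Field K] [Algebra F K]
    [AddCommGroup A] {χ : AddChar A (AddChar A K)} {a : A} (h : IsTypeI a) :
    (componentChar F χ a)⁻¹ = componentChar F χ a := by
  refine DFunLike.ext _ _ fun g => Subtype.ext ?_
  rw [coe_componentChar_inv, ← show a = -a from h, coe_componentChar]

section Involution

variable {F K A : Type*} [Field F] [Finite F] [CharP F 2] [Field K] [Algebra F K]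
  [AddCommGroup A] {χ : AddChar A (AddChar A K)} {k s : ℕ}

/-- Here `χ a (-g) = χ (-a) g = χ a g ^ 2 ^ (k n)`, while the same Frobenius power fixes `F`. -/
theorem componentHom_conjHom_dualFrobenius [∀ i, CharP (componentField F χ i) 2]
    (hF : Nat.card F = 2 ^ k) {a : A} {n : ℕ} (ha : -a = 2 ^ (k * n) • a)
    (x : AddMonoidAlgebra F (A × ZMod 2 × ZMod (2 ^ s))) :
    componentHom s (componentChar F χ a) (conjHom (RingHom.id F) x) =
      conjHom (dualFrobenius (componentField F χ a) (k * n))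
        (componentHom s (componentChar F χ a) x) := by
  have inl_apply (t : componentField F χ a) :
      dualFrobenius (componentField F χ a) (k * n) (TrivSqZeroExt.inl t) =
        TrivSqZeroExt.inl (t ^ 2 ^ (k * n)) := by
    ext <;> simp [dualFrobenius, iterateFrobenius_def]
  refine componentHom_conjHom ?_ (fun α => ?_) (fun g => ?_) x
  · ext <;> simp [dualFrobenius]
  · refine (inl_apply _).trans ?_
    rw [← map_pow, pow_two_pow_mul hF]
    rfl
  · refine (inl_apply _).trans (congrArg TrivSqZeroExt.inl (Subtype.ext ?_))
    change χ a g ^ 2 ^ (k * n) = χ a (-g)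
    rw [← apply_nsmul, ← ha, AddChar.map_neg_eq_inv χ, AddChar.inv_apply]

end Involution

end AbelianCode

end

/-! ### The main theorem -/

open AbelianCode in
theorem corollary2p2
    (k s : ℕ) (hk : 0 < k) (hs : 0 < s)
    (F : Type*) [Field F] [Finite F] [CharP F 2] (hF : Nat.card F = 2 ^ k)
    (A : Type*) [AddCommGroup A] [Fintype A] (hA : Odd (Fintype.card A))
    (K : Type*) [Field K] [Algebra F K]
    (χ : AddChar A (AddChar A K)) (hχ : Function.Injective χ)
    (r₁ r₂ r₃ : ℕ) (a : Fin r₁ → A) (b : Fin r₂ → A) (c : Fin r₃ → A)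
    (ha : IsRepresentatives k IsTypeI a)
    (hb : IsRepresentatives k (IsTypeII k) b)
    (hc : IsRepresentatives k (IsTypeIII k) (Sum.elim c fun l => -c l)) :
    -- the component rings are over the fields of order `2 ^ k` and `2 ^ (k |S(a)|)`,
    -- which is a square for type II
    (∀ i, Nat.card (componentField F χ (a i)) = 2 ^ k) ∧
    (∀ j, Nat.card (componentField F χ (b j)) = 2 ^ (k * (cyclotomicClass k (b j)).ncard) ∧
      Even (k * (cyclotomicClass k (b j)).ncard)) ∧
    (∀ l, Nat.card (componentField F χ (c l)) = 2 ^ (k * (cyclotomicClass k (c l)).ncard)) ∧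
    -- the group algebra is isomorphic to the product of the component rings
    Function.Bijective (decomposition F χ s a b c) ∧
    ∀ C : Ideal (AddMonoidAlgebra F (A × ZMod 2 × ZMod (2 ^ s))),
      -- under this isomorphism `C` is the product of its components
      (decomposition F χ s a b c '' C =
        {x | (∀ i, x.1 i ∈ component χ s C (a i)) ∧ (∀ j, x.2.1 j ∈ component χ s C (b j)) ∧
          ∀ l, (x.2.2 l).1 ∈ component χ s C (c l) ∧ (x.2.2 l).2 ∈ componentNeg χ s C (c l)}) ∧
      (IsEuclideanSelfDual C ↔
        (∀ i, IsEuclideanSelfDual (component χ s C (a i))) ∧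
        (∀ j, IsHermitianSelfDual (component χ s C (b j))) ∧
        ∀ l, (componentNeg χ s C (c l) :
            Set (AddMonoidAlgebra (DualNumber (componentField F χ (c l))) (ZMod (2 ^ s)))) =
          euclideanDual (component χ s C (c l))) := by
  have hchar : ∀ x, CharP (componentField F χ x) 2 := fun x =>
    charP_of_injective_algebraMap (algebraMap F (componentField F χ x)).injective 2
  have hcardL := card_componentField (F := F) χ hF hA hχ hk
  choose n hn hneg using fun j => (hb.1 j).exists_half hA
  let T (i : Fin r₁ ⊕ Fin r₂ ⊕ Fin r₃ ⊕ Fin r₃) :=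
    AddMonoidAlgebra (componentField F χ (Sum.elim a (Sum.elim b (Sum.elim c c)) i))[ε]
      (ZMod (2 ^ s))
  let φ (i) : AddMonoidAlgebra F (A × ZMod 2 × ZMod (2 ^ s)) →+* T i :=
    (componentHom s (indexedChar F χ a b c i)).toRingHom
  have hφ : Function.Bijective fun x i => φ i x :=
    bijective_pi_componentHom hχ hF hA (coe_indexedChar χ a b c)
      (exists_mem_cyclotomicClass ha hb hc) (eq_of_cyclotomicClass_eq hA ha hb hc) (by
        rintro (i | j | l | l)
        · exact hcardL _
        · exact hcardL _
        · exact hcardL _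
        · exact (hcardL _).trans (by rw [← ncard_cyclotomicClass_neg]; rfl))
  have hbij : Function.Bijective (decomposition F χ s a b c) := by
    constructor
    · intro x y hxy
      refine hφ.1 (funext ?_)
      rintro (i | j | l | l)
      · exact congrFun (congrArg (fun z => z.1) hxy) i
      · exact congrFun (congrArg (fun z => z.2.1) hxy) j
      · exact congrArg Prod.fst (congrFun (congrArg (fun z => z.2.2) hxy) l)
      · exact congrArg Prod.snd (congrFun (congrArg (fun z => z.2.2) hxy) l)
    · rintro ⟨u, v, w⟩
      obtain ⟨x, hx⟩ := hφ.2 fun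
        | .inl i => u i
        | .inr (.inl j) => v j
        | .inr (.inr (.inl l)) => (w l).1
        | .inr (.inr (.inr l)) => (w l).2
      refine ⟨x, Prod.ext (funext fun i => congrFun hx (.inl i))
        (Prod.ext (funext fun j => congrFun hx (.inr (.inl j))) (funext fun l =>
          Prod.ext (congrFun hx (.inr (.inr (.inl l)))) (congrFun hx (.inr (.inr (.inr l))))))⟩
  refine ⟨fun i => ?_, fun j => ⟨hcardL _, ?_⟩, fun l => hcardL _, hbij, fun C => ⟨?_, ?_⟩⟩
  · rw [hcardL, (ha.1 i).eq_zero hA, ncard_cyclotomicClass_zero, mul_one]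
  · rw [hn, ← mul_assoc]
    exact even_two.mul_left _
  · have hmem x : x ∈ C ↔ (∀ i, componentHom s (componentChar F χ (a i)) x ∈ component χ s C (a i)) ∧
        (∀ j, componentHom s (componentChar F χ (b j)) x ∈ component χ s C (b j)) ∧
        ∀ l, componentHom s (componentChar F χ (c l)) x ∈ component χ s C (c l) ∧
          componentHom s (componentChar F χ (c l))⁻¹ x ∈ componentNeg χ s C (c l) := by
      rw [mem_iff_forall_mem_map (T := T) (φ := φ) hφ, Sum.forall, Sum.forall, Sum.forall, forall_and]
      rfl
    ext y
    obtain ⟨x, rfl⟩ := hbij.2 y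
    rw [hbij.1.mem_set_image]
    exact hmem x
  · have hσ : ∀ i x, φ i (conjHom (RingHom.id F) x) =
        conjComponent χ a b c s (fun j => k * n j) i (φ (conjIndex i) x) := by
      rintro (i | j | l | l) x
      · have h := componentHom_inv_conjHom (componentChar F χ (a i)) x
        rw [componentChar_inv_of_isTypeI (ha.1 i)] at h
        exact h
      · exact componentHom_conjHom_dualFrobenius hF (hneg j) x
      · have h := componentHom_inv_conjHom (componentChar F χ (c l))⁻¹ x
        rw [inv_inv] at h
        exact h
      · exact componentHom_inv_conjHom (componentChar F χ (c l)) x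
    rw [IsEuclideanSelfDual, ← coe_eq_euclideanDual_iff,
      coe_eq_annihilator_iff (T := T) (φ := φ) hφ C _ conjIndex _ hσ, Sum.forall, Sum.forall, Sum.forall]
    -- The indices of type III give both `D = D'^⊥` and `D' = D^⊥`; the first is recovered from the
    -- second by double duality.
    refine and_congr (forall_congr' fun i => coe_eq_euclideanDual_iff _ _)
      (and_congr (forall_congr' fun j => ?_) ⟨fun h l =>
        (coe_eq_euclideanDual_iff _ _).1 (h.2 l), fun h =>
        ⟨fun l => (coe_eq_euclideanDual_iff _ _).2 (eq_euclideanDual_symm (h l)), fun l =>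
          (coe_eq_euclideanDual_iff _ _).2 (h l)⟩⟩)
    have hcard : Nat.card (componentField F χ (b j)) = 2 ^ (k * n j * 2) := by
      rw [hcardL, hn, mul_assoc]
    rw [IsHermitianSelfDual, show hermitianDual (component χ s C (b j)) = _ from
      Set.ext fun x => mem_hermitianDual_iff hcard (component χ s C (b j)) x]
    rfl
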